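/- Let $f : X \to Y$ be a functor between small categories. For an arrow $\alpha : x \to y$ of $Y$, let $[\alpha]$ be the category of factorizations of $\alpha$: its objects are the triples $(z,\, a : x \to z,\, b : z \to y)$ with $b a = \alpha$, and its arrows $(z,a,b) \to (z',a',b')$ are the arrows $h : z \to z'$ with $h a = a'$ and $b' h = b$; it has the projection $[\alpha] \to Y$, $(z,a,b) \mapsto z$. Let $f^* : \mathbf{Cat}/Y \to \mathbf{Cat}/X$ denote pullback along $f$. A category is connected if it has exactly one connected component (in particular it is non-empty). A functor $p : P \to Q$ is final (resp. initial) if the comma category $q \backslash p$ (resp. $p / q$) is connected for every object $q$ of $Q$. A functor $p : P \to Q$ is a discrete fibration (resp. discrete opfibration) if for every object $a$ of $P$ and every arrow $g : q \to p(a)$ (resp. $g : p(a) \to q$) of $Q$ there is exactly one arrow of $P$ with codomain (resp. domain) $a$ that $p$ maps to $g$; these functors are stable under pullback. Let $\mathcal{M}/Y$ and $\mathcal{M}'/Y$ be the full subcategories of $\mathbf{Cat}/Y$ consisting of the discrete fibrations and of the discrete opfibrations, respectively. Then the following are equivalent: 1. $f^*[\alpha]$ is connected, for every arrow $\alpha$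 of $Y$; 2. $f$ is locally final: for every object $y$ of $Y$, the projection $f/y \to Y/y$ (the pullback of $f$ along the slice projection $Y/y \to Y$) is final; 3. $f$ is locally initial: for every object $y$ of $Y$, the projection $y\backslash f \to y\backslash Y$ (the pullback of $f$ along the coslice projection $y\backslash Y \to Y$) is initial; 4. the pullback functor $f^* : \mathcal{M}/Y \to \mathcal{M}/X$ is full and faithful; 5. the pullback functor $f^* : \mathcal{M}'/Y \to \mathcal{M}'/X$ is full and faithful. -/

import Mathlib

open CategoryTheory

attribute [-instance] CategoryTheory.catToReflQuiver

universe v u v₁ v₂ v₃ u₁ u₂ u₃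

section StrictPullback

variable {A : Type u₁} [Category.{v₁} A] {B : Type u₂} [Category.{v₂} B]
  {C : Type u₃} [Category.{v₃} C]

/-- The (strict) pullback of two functors `F : A ⥤ C` and `G : B ⥤ C`: its objects are the pairs
of objects with equal image in `C`. -/
structure StrictPullback (F : A ⥤ C) (G : B ⥤ C) : Type (max u₁ u₂) where
  fst : A
  snd : B
  w : F.obj fst = G.obj snd

namespace StrictPullback

variable {F : A ⥤ C} {G : B ⥤ C}

/-- Arrows of the strict pullback are the pairs of arrows with equal image in `C`. -/
@[ext]
structure Hom (P Q : StrictPullback F G) : Type (max v₁ v₂) where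
  fst : P.fst ⟶ Q.fst
  snd : P.snd ⟶ Q.snd
  w : F.map fst ≫ eqToHom Q.w = eqToHom P.w ≫ G.map snd

instance : Category.{max v₁ v₂} (StrictPullback F G) where
  Hom P Q := Hom P Q
  id P := { fst := 𝟙 _, snd := 𝟙 _, w := by simp }
  comp f g :=
    { fst := f.fst ≫ g.fst
      snd := f.snd ≫ g.snd
      w := by rw [F.map_comp, G.map_comp, Category.assoc, g.w, ← Category.assoc, f.w,
        Category.assoc] }

@[ext]
theorem hom_ext {P Q : StrictPullback F G} {f g : P ⟶ Q} (h₁ : f.fst = g.fst)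
    (h₂ : f.snd = g.snd) : f = g :=
  Hom.ext h₁ h₂

variable (F G)

/-- The first projection of the strict pullback, that is, the pullback of `G` along `F`. -/
@[simps]
def fstFunctor : StrictPullback F G ⥤ A where
  obj P := P.fst
  map f := f.fst

/-- The second projection of the strict pullback, that is, the pullback of `F` along `G`. -/
@[simps]
def sndFunctor : StrictPullback F G ⥤ B where
  obj P := P.snd
  map f := f.snd

/-- The pullback square commutes on the nose. -/
theorem condition : fstFunctor F G ⋙ F = sndFunctor F G ⋙ G :=
  CategoryTheory.Functor.ext (fun P => P.w) (fun P Q f => by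
    have h : F.map f.fst = (eqToHom P.w ≫ G.map f.snd) ≫ eqToHom Q.w.symm := by
      rw [← f.w]; simp
    exact h.trans (Category.assoc _ _ _))

variable {F G}

/-- The functor into the strict pullback induced by a strictly commuting square. -/
@[simps]
def lift {D : Type*} [Category* D] (S : D ⥤ A) (T : D ⥤ B) (h : S ⋙ F = T ⋙ G) :
    D ⥤ StrictPullback F G where
  obj d := ⟨S.obj d, T.obj d, Functor.congr_obj h d⟩
  map k := ⟨S.map k, T.map k, by
    have := Functor.congr_hom h k
    simp only [Functor.comp_map] at this
    rw [this]
    simp⟩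
  map_id d := hom_ext (S.map_id d) (T.map_id d)
  map_comp k l := hom_ext (S.map_comp k l) (T.map_comp k l)

end StrictPullback

/-- A functor `p : A ⥤ C` is a discrete fibration if every arrow `c ⟶ p a` of `C` has exactly one
lift with codomain `a`. -/
def IsDiscreteFibration (p : A ⥤ C) : Prop :=
  ∀ (a : A) {c : C} (g : c ⟶ p.obj a), ∃! h : (Σ b : A, b ⟶ a), p.IsHomLift g h.2

/-- A functor `p : A ⥤ C` is a discrete opfibration if every arrow `p a ⟶ c` of `C` has exactly one
lift with domain `a`. -/
def IsDiscreteOpfibration (p : A ⥤ C) : Prop :=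
  ∀ (a : A) {c : C} (g : p.obj a ⟶ c), ∃! h : (Σ b : A, a ⟶ b), p.IsHomLift g h.2

/-- Discrete fibrations are stable under pullback. -/
theorem IsDiscreteFibration.fstFunctor {G : B ⥤ C} (hG : IsDiscreteFibration G) (F : A ⥤ C) :
    IsDiscreteFibration (StrictPullback.fstFunctor F G) := by
  intro P a' g
  obtain ⟨⟨b', k⟩, hk, huniq⟩ := hG P.snd (F.map g ≫ eqToHom P.w)
  have hb' : G.obj b' = F.obj a' := IsHomLift.domain_eq G (F.map g ≫ eqToHom P.w) k
  have hfac : F.map g ≫ eqToHom P.w = eqToHom hb'.symm ≫ G.map k := by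
    simpa using IsHomLift.fac G (F.map g ≫ eqToHom P.w) k
  let Q : StrictPullback F G := ⟨a', b', hb'.symm⟩
  let l : Q ⟶ P := ⟨g, k, hfac⟩
  refine ⟨⟨Q, l⟩, IsHomLift.map (StrictPullback.fstFunctor F G) l, ?_⟩
  rintro ⟨Q', l'⟩ (hl : (StrictPullback.fstFunctor F G).IsHomLift g l')
  obtain rfl : Q'.fst = a' := IsHomLift.domain_eq (StrictPullback.fstFunctor F G)
    (S := (StrictPullback.fstFunctor F G).obj P) g l'
  obtain rfl : g = l'.fst := @IsHomLift.eq_of_isHomLift _ _ _ _ (StrictPullback.fstFunctor F G)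
    Q' P g l' hl
  have := huniq ⟨Q'.snd, l'.snd⟩
    (IsHomLift.of_fac G _ _ Q'.w.symm rfl
      (by rw [eqToHom_refl, Category.comp_id]; exact l'.w))
  obtain ⟨x, y, z⟩ := Q'
  obtain ⟨l₁, l₂, lw⟩ := l'
  obtain ⟨rfl, h⟩ := Sigma.mk.inj this
  obtain rfl := eq_of_heq h
  rfl

/-- Discrete opfibrations are stable under pullback. -/
theorem IsDiscreteOpfibration.fstFunctor {G : B ⥤ C} (hG : IsDiscreteOpfibration G) (F : A ⥤ C) :
    IsDiscreteOpfibration (StrictPullback.fstFunctor F G) := by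
  intro P a' g
  obtain ⟨⟨b', k⟩, hk, huniq⟩ := hG P.snd (eqToHom P.w.symm ≫ F.map g)
  have hb' : G.obj b' = F.obj a' := IsHomLift.codomain_eq G (eqToHom P.w.symm ≫ F.map g) k
  have hfac : F.map g ≫ eqToHom hb'.symm = eqToHom P.w ≫ G.map k := by
    simp [IsHomLift.fac' G (eqToHom P.w.symm ≫ F.map g) k]
    rfl
  let Q : StrictPullback F G := ⟨a', b', hb'.symm⟩
  let l : P ⟶ Q := ⟨g, k, hfac⟩
  refine ⟨⟨Q, l⟩, IsHomLift.map (StrictPullback.fstFunctor F G) l, ?_⟩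
  rintro ⟨Q', l'⟩ (hl : (StrictPullback.fstFunctor F G).IsHomLift g l')
  obtain rfl : Q'.fst = a' := IsHomLift.codomain_eq (StrictPullback.fstFunctor F G)
    (R := (StrictPullback.fstFunctor F G).obj P) g l'
  obtain rfl : g = l'.fst := @IsHomLift.eq_of_isHomLift _ _ _ _ (StrictPullback.fstFunctor F G)
    P Q' g l' hl
  have := huniq ⟨Q'.snd, l'.snd⟩
    (IsHomLift.of_fac' G _ _ rfl Q'.w.symm (by simp [l'.w]))
  obtain ⟨x, y, z⟩ := Q'
  obtain ⟨l₁, l₂, lw⟩ := l'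
  obtain ⟨rfl, h⟩ := Sigma.mk.inj this
  obtain rfl := eq_of_heq h
  rfl

end StrictPullback

section Slices

/-- The pullback functor `f^* : Cat/Y ⥤ Cat/X` along a functor `f : X ⟶ Y`. -/
def catPullback {X Y : Cat.{v, u}} (f : X ⟶ Y) : Over Y ⥤ Over X where
  obj p := Over.mk (Y := Cat.of (StrictPullback f.toFunctor p.hom.toFunctor))
    (Cat.Hom.ofFunctor (StrictPullback.fstFunctor f.toFunctor p.hom.toFunctor))
  map {p _} k := Over.homMk
    (Cat.Hom.ofFunctor (StrictPullback.lift
      (StrictPullback.fstFunctor f.toFunctor p.hom.toFunctor)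
      (StrictPullback.sndFunctor f.toFunctor p.hom.toFunctor ⋙ k.left.toFunctor)
      ((StrictPullback.condition f.toFunctor p.hom.toFunctor).trans
        (congrArg (StrictPullback.sndFunctor f.toFunctor p.hom.toFunctor ⋙ ·)
          (congrArg Cat.Hom.toFunctor (Over.w k)).symm))))
    rfl
  map_id _ := rfl
  map_comp _ _ := rfl

/-- The discrete fibrations over `Y`, as a property of objects of `Cat/Y`. -/
def discreteFibrations (Y : Cat.{v, u}) : ObjectProperty (Over Y) :=
  fun p => IsDiscreteFibration p.hom.toFunctor

/-- The discrete opfibrations over `Y`, as a property of objects of `Cat/Y`. -/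
def discreteOpfibrations (Y : Cat.{v, u}) : ObjectProperty (Over Y) :=
  fun p => IsDiscreteOpfibration p.hom.toFunctor

/-- The functor `f^* : M/Y ⥤ M/X` between the full subcategories of discrete fibrations. -/
def discreteFibrationPullback {X Y : Cat.{v, u}} (f : X ⟶ Y) :
    (discreteFibrations Y).FullSubcategory ⥤ (discreteFibrations X).FullSubcategory :=
  (discreteFibrations X).lift ((discreteFibrations Y).ι ⋙ catPullback f)
    (fun p => IsDiscreteFibration.fstFunctor p.property f.toFunctor)

/-- The functor `f^* : M'/Y ⥤ M'/X` between the full subcategories of discrete opfibrations. -/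
def discreteOpfibrationPullback {X Y : Cat.{v, u}} (f : X ⟶ Y) :
    (discreteOpfibrations Y).FullSubcategory ⥤ (discreteOpfibrations X).FullSubcategory :=
  (discreteOpfibrations X).lift ((discreteOpfibrations Y).ι ⋙ catPullback f)
    (fun p => IsDiscreteOpfibration.fstFunctor p.property f.toFunctor)

end Slices

section LocallyFinal

variable {X : Type u₁} [Category.{v₁} X] {Y : Type u₂} [Category.{v₂} Y]

/-- `f : X ⥤ Y` is locally final if for every `y : Y` the projection `f/y ⥤ Y/y`, the pullback of
`f` along the slice projection `Y/y ⥤ Y`, is final. -/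
def IsLocallyFinal (f : X ⥤ Y) : Prop :=
  ∀ y : Y, (StrictPullback.sndFunctor f (Over.forget y)).Final

/-- `f : X ⥤ Y` is locally initial if for every `y : Y` the projection `y\f ⥤ y\Y`, the pullback of
`f` along the coslice projection `y\Y ⥤ Y`, is initial. -/
def IsLocallyInitial (f : X ⥤ Y) : Prop :=
  ∀ y : Y, (StrictPullback.sndFunctor f (Under.forget y)).Initial

end LocallyFinal

/-!
All five conditions are equivalent to `HasConnectedFactorisations f`: for every arrow `α : x ⟶ y` of
`Y`, the category of factorisations `x ⟶ f z ⟶ y` of `α` is connected. That category is equivalent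
to `f^*[α]`, to the comma category `α \ (f/y ⥤ Y/y)` and to the comma category `(x\f ⥤ x\Y) / α`,
so the first three conditions just restate its connectedness. It is also self-dual in `f`, so only
one of the last two conditions needs an argument; it is given for discrete opfibrations.

Full faithfulness of `f^*` on discrete opfibrations says that a functor `k : f^*P ⥤ Q` lying over `f`
has a unique extension `K : P ⥤ Q` over `Y` (`ExtendsUniquely`).

If factorisations are connected, let `s` be an object of `P` over `x`. Given a factorisation
`x ⟶ f z ⟶ x` of the identity, transport `s` along the first factor, apply `k` at `z` and transport
the result along the second factor. By connectedness the outcome does not depend on the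
factorisation, and it is the only possible value of `K s`. Functoriality of `K` follows by comparing
with factorisations of the other arrows of `Y`
(`HasConnectedFactorisations.extendsUniquely`).

Conversely, for an object `x` of `Y` let `L` be the functor sending `y` to the set of components of
the category of pairs `x ⟶ f z ⟶ y` (`FactoredArrow.components`). Sending `a : x ⟶ f z` to the
class of `x ⟶ f z ⟶ f z`, with second factor the identity, is a functor over `f` from `f^*(x\Y)` to
the elements of `L`. Its extension to `x\Y` maps `α` to a class that contains every factorisation of
`α`, and uniqueness of extensions from `x\Y` to itself shows that the members of this class do
compose to `α` (`isConnected_factorisationThrough`).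
-/

/-! ### Factorisations through a functor -/

/-- The compatibility condition on arrows of a strict pullback whose objects are given by
definitional equalities. -/
theorem comp_eqToHom_self_iff {C : Type u₁} [Category.{v₁} C] {a b : C} {g g' : a ⟶ b} (h : b = b)
    (h' : a = a) : g ≫ eqToHom h = eqToHom h' ≫ g' ↔ g = g' := by
  simp

section Factorisations

variable {X : Type u₁} [Category.{v₁} X] {Y : Type u₂} [Category.{v₂} Y]

/-- The category of factorisations of an arrow `α : x ⟶ y` of `Y` through objects in the image of
`f : X ⥤ Y`: an object is an object `mid` of `X` with arrows `ι : x ⟶ f mid` and `π : f mid ⟶ y`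
such that `ι ≫ π = α`. It is the pullback `f^*[α]`, with the equality of objects in
`StrictPullback` eliminated. -/
structure FactorisationThrough (f : X ⥤ Y) {x y : Y} (α : x ⟶ y) where
  /-- The object of `X` through which the arrow factors. -/
  mid : X
  /-- The first factor. -/
  ι : x ⟶ f.obj mid
  /-- The second factor. -/
  π : f.obj mid ⟶ y
  ι_π : ι ≫ π = α

namespace FactorisationThrough

variable {f : X ⥤ Y} {x y : Y} {α : x ⟶ y}

/-- An arrow of factorisations is an arrow of `X` between the middle objects, compatible with both
factors. -/
@[ext]
structure Hom (s t : FactorisationThrough f α) where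
  /-- The underlying arrow of `X`. -/
  h : s.mid ⟶ t.mid
  ι_h : s.ι ≫ f.map h = t.ι
  h_π : f.map h ≫ t.π = s.π

instance : Category.{v₁} (FactorisationThrough f α) where
  Hom s t := Hom s t
  id s := ⟨𝟙 _, by simp, by simp⟩
  comp k l := ⟨k.h ≫ l.h, by simp [reassoc_of% k.ι_h, l.ι_h], by simp [l.h_π, k.h_π]⟩

@[ext]
theorem hom_ext {s t : FactorisationThrough f α} {k l : s ⟶ t} (w : k.h = l.h) : k = l :=
  Hom.ext w

variable (f α)

/-- The comparison functor to the strict pullback `f^*[α]`. -/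
def toStrictPullback :
    FactorisationThrough f α ⥤ StrictPullback f (Factorisation.forget (f := α)) where
  obj s := ⟨s.mid, ⟨f.obj s.mid, s.ι, s.π, s.ι_π⟩, rfl⟩
  map k := ⟨k.h, ⟨f.map k.h, k.ι_h, k.h_π⟩, (comp_eqToHom_self_iff rfl rfl).2 rfl⟩
  map_id _ := StrictPullback.hom_ext rfl (Factorisation.Hom.ext (f.map_id _))
  map_comp _ _ := StrictPullback.hom_ext rfl (Factorisation.Hom.ext (f.map_comp _ _))

instance : (toStrictPullback f α).IsEquivalence where
  faithful := ⟨fun h => hom_ext (congrArg StrictPullback.Hom.fst h)⟩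
  full := ⟨fun {s t} k => by
    obtain ⟨h, m, w⟩ := k
    have w : f.map h = m.h := (comp_eqToHom_self_iff rfl rfl).1 w
    exact ⟨⟨h, (congrArg (s.ι ≫ ·) w).trans m.ι_h, (congrArg (· ≫ t.π) w).trans m.h_π⟩,
      StrictPullback.hom_ext rfl (Factorisation.Hom.ext w)⟩⟩
  essSurj := ⟨fun ⟨z, ⟨m, a, b, h⟩, w⟩ => by
    obtain rfl : f.obj z = m := w
    exact ⟨⟨z, a, b, h⟩, ⟨Iso.refl _⟩⟩⟩

/-- The comparison functor to the comma category `α \ (f/y ⥤ Y/y)`. -/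
def toStructuredArrow :
    FactorisationThrough f α ⥤
      StructuredArrow (Over.mk α) (StrictPullback.sndFunctor f (Over.forget y)) where
  obj s := StructuredArrow.mk (Y := (⟨s.mid, Over.mk s.π, rfl⟩ : StrictPullback f (Over.forget y)))
    (Over.homMk s.ι s.ι_π)
  map {s t} k := StructuredArrow.homMk
    (⟨k.h, Over.homMk (U := Over.mk s.π) (V := Over.mk t.π) (f.map k.h) k.h_π,
        (comp_eqToHom_self_iff rfl rfl).2 rfl⟩ :
      StrictPullback.Hom (F := f) (G := Over.forget y) ⟨s.mid, Over.mk s.π, rfl⟩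
        ⟨t.mid, Over.mk t.π, rfl⟩)
    (Over.OverMorphism.ext k.ι_h)
  map_id s := StructuredArrow.hom_ext _ _
    (StrictPullback.hom_ext rfl (Over.OverMorphism.ext (f.map_id s.mid)))
  map_comp k l := StructuredArrow.hom_ext _ _
    (StrictPullback.hom_ext rfl (Over.OverMorphism.ext (f.map_comp k.h l.h)))

instance : (toStructuredArrow f α).IsEquivalence where
  faithful := ⟨fun h => hom_ext (congrArg (fun k => StrictPullback.Hom.fst k.right) h)⟩
  full := ⟨fun {s t} k => by
    have w : f.map (StrictPullback.Hom.fst k.right : s.mid ⟶ t.mid) =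
        (StrictPullback.Hom.snd k.right).left :=
      (comp_eqToHom_self_iff rfl rfl).1 (StrictPullback.Hom.w k.right)
    exact ⟨⟨k.right.fst, (congrArg (s.ι ≫ ·) w).trans
        (congrArg CommaMorphism.left (StructuredArrow.w k)),
      (congrArg (· ≫ t.π) w).trans (Over.w (StrictPullback.Hom.snd k.right))⟩,
      StructuredArrow.hom_ext _ _ (StrictPullback.hom_ext rfl (Over.OverMorphism.ext w))⟩⟩
  essSurj := ⟨fun ⟨_, ⟨z, ⟨m, _, b⟩, w⟩, a⟩ => by
    obtain rfl : f.obj z = m := w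
    exact ⟨⟨z, a.left, b, Over.w a⟩, ⟨Iso.refl _⟩⟩⟩

/-- The comparison functor to the comma category `(x\f ⥤ x\Y) / α`. -/
def toCostructuredArrow :
    FactorisationThrough f α ⥤
      CostructuredArrow (StrictPullback.sndFunctor f (Under.forget x)) (Under.mk α) where
  obj s := CostructuredArrow.mk
    (Y := (⟨s.mid, Under.mk s.ι, rfl⟩ : StrictPullback f (Under.forget x)))
    (Under.homMk s.π s.ι_π)
  map {s t} k := CostructuredArrow.homMk
    (⟨k.h, Under.homMk (U := Under.mk s.ι) (V := Under.mk t.ι) (f.map k.h) k.ι_h,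
        (comp_eqToHom_self_iff rfl rfl).2 rfl⟩ :
      StrictPullback.Hom (F := f) (G := Under.forget x) ⟨s.mid, Under.mk s.ι, rfl⟩
        ⟨t.mid, Under.mk t.ι, rfl⟩)
    (Under.UnderMorphism.ext k.h_π)
  map_id s := CostructuredArrow.hom_ext _ _
    (StrictPullback.hom_ext rfl (Under.UnderMorphism.ext (f.map_id s.mid)))
  map_comp k l := CostructuredArrow.hom_ext _ _
    (StrictPullback.hom_ext rfl (Under.UnderMorphism.ext (f.map_comp k.h l.h)))

instance : (toCostructuredArrow f α).IsEquivalence where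
  faithful := ⟨fun h => hom_ext (congrArg (fun k => StrictPullback.Hom.fst k.left) h)⟩
  full := ⟨fun {s t} k => by
    have w : f.map (StrictPullback.Hom.fst k.left : s.mid ⟶ t.mid) =
        (StrictPullback.Hom.snd k.left).right :=
      (comp_eqToHom_self_iff rfl rfl).1 (StrictPullback.Hom.w k.left)
    exact ⟨⟨k.left.fst, (congrArg (s.ι ≫ ·) w).trans (Under.w (StrictPullback.Hom.snd k.left)),
      (congrArg (· ≫ t.π) w).trans (congrArg CommaMorphism.right (CostructuredArrow.w k))⟩,
      CostructuredArrow.hom_ext _ _ (StrictPullback.hom_ext rfl (Under.UnderMorphism.ext w))⟩⟩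
  essSurj := ⟨fun ⟨⟨z, ⟨_, m, a⟩, w⟩, _, b⟩ => by
    obtain rfl : f.obj z = m := w
    exact ⟨⟨z, a, b.right, Under.w b⟩, ⟨Iso.refl _⟩⟩⟩

/-- The comparison functor to the opposite of the category of factorisations of `α.op` through
`f.op`. -/
def toOp : FactorisationThrough f α ⥤ (FactorisationThrough f.op α.op)ᵒᵖ where
  obj s := .op ⟨.op s.mid, s.π.op, s.ι.op, congrArg Quiver.Hom.op s.ι_π⟩
  map k := .op ⟨k.h.op, congrArg Quiver.Hom.op k.h_π, congrArg Quiver.Hom.op k.ι_h⟩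

instance : (toOp f α).IsEquivalence where
  faithful := ⟨fun {s t} _ _ h => hom_ext (congrArg
    (fun k : (toOp f α).obj s ⟶ (toOp f α).obj t => (Hom.h k.unop).unop) h)⟩
  full := ⟨fun k => ⟨⟨k.unop.h.unop, congrArg Quiver.Hom.unop k.unop.h_π,
    congrArg Quiver.Hom.unop k.unop.ι_h⟩, rfl⟩⟩
  essSurj := ⟨fun ⟨⟨z, a, b, h⟩⟩ =>
    ⟨⟨z.unop, b.unop, a.unop, congrArg Quiver.Hom.unop h⟩, ⟨Iso.refl _⟩⟩⟩

end FactorisationThrough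

/-- Every arrow of `Y` has a connected category of factorisations through `f`. -/
def HasConnectedFactorisations (f : X ⥤ Y) : Prop :=
  ∀ ⦃x y : Y⦄ (α : x ⟶ y), IsConnected (FactorisationThrough f α)

variable (f : X ⥤ Y)

theorem isConnected_strictPullback_factorisation_iff :
    (∀ {x y : Y} (α : x ⟶ y),
      IsConnected (StrictPullback f (Factorisation.forget (f := α)))) ↔
      HasConnectedFactorisations f := by
  unfold HasConnectedFactorisations
  congr! 3 with x y α
  exact (isConnected_iff_of_equivalence
    (FactorisationThrough.toStrictPullback f α).asEquivalence).symm

theorem isLocallyFinal_iff : IsLocallyFinal f ↔ HasConnectedFactorisations f := by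
  refine ⟨fun h x y α => ?_, fun h y => ⟨fun ⟨x, _, α⟩ => ?_⟩⟩
  · have := h y
    exact (isConnected_iff_of_equivalence
      (FactorisationThrough.toStructuredArrow f α).asEquivalence).2 inferInstance
  · have := h α
    exact isConnected_of_equivalent (FactorisationThrough.toStructuredArrow f α).asEquivalence

theorem isLocallyInitial_iff : IsLocallyInitial f ↔ HasConnectedFactorisations f := by
  refine ⟨fun h x y α => ?_, fun h x => ⟨fun ⟨_, y, α⟩ => ?_⟩⟩
  · have := h x
    exact (isConnected_iff_of_equivalence
      (FactorisationThrough.toCostructuredArrow f α).asEquivalence).2 inferInstance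
  · have := h α
    exact isConnected_of_equivalent (FactorisationThrough.toCostructuredArrow f α).asEquivalence

theorem hasConnectedFactorisations_op_iff :
    HasConnectedFactorisations f.op ↔ HasConnectedFactorisations f := by
  have key {x y : Y} (α : x ⟶ y) : IsConnected (FactorisationThrough f α) ↔
      IsConnected (FactorisationThrough f.op α.op) :=
    (isConnected_iff_of_equivalence (FactorisationThrough.toOp f α).asEquivalence).trans
      (isConnected_op_iff_isConnected _)
  exact ⟨fun h x y α => (key α).2 (h α.op), fun h x y α => (key α.unop).1 (h α.unop)⟩

end Factorisations

/-! ### Transport along discrete opfibrations -/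

section Transport

variable {P : Type u₁} [Category.{v₁} P] {Y : Type u₂} [Category.{v₂} Y]

/-- `Transports p g a b` says that `b` is the codomain of an arrow with domain `a` over `g`. For a
discrete opfibration `p` it is the graph of the action of `g` on the fibres. -/
def Transports (p : P ⥤ Y) {y y' : Y} (g : y ⟶ y') (a b : P) : Prop :=
  ∃ φ : a ⟶ b, p.IsHomLift g φ

namespace Transports

variable {p : P ⥤ Y} {y y' y'' : Y} {g : y ⟶ y'} {g' : y' ⟶ y''} {a b c : P}

theorem comp (h : Transports p g a b) (h' : Transports p g' b c) : Transports p (g ≫ g') a c := by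
  obtain ⟨φ, _⟩ := h
  obtain ⟨ψ, _⟩ := h'
  exact ⟨φ ≫ ψ, inferInstance⟩

theorem obj_codomain (h : Transports p g a b) : p.obj b = y' := by
  obtain ⟨φ, _⟩ := h
  exact IsHomLift.codomain_eq p g φ

theorem map (p : P ⥤ Y) (φ : a ⟶ b) : Transports p (p.map φ) a b :=
  ⟨φ, inferInstance⟩

theorem eqToHom (ha : p.obj a = y) (ha' : p.obj a = y') (h : y = y') :
    Transports p (eqToHom h) a a := by
  subst ha h
  exact ⟨𝟙 a, IsHomLift.id rfl⟩

/-- A functor over `Y` preserves transport. -/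
theorem map_functor {Q : Type u₃} [Category.{v₃} Q] {q : Q ⥤ Y} {K : P ⥤ Q} (hK : K ⋙ q = p)
    (h : Transports p g a b) : Transports q g (K.obj a) (K.obj b) := by
  subst hK
  obtain ⟨φ, hφ⟩ := h
  obtain ⟨⟩ := hφ
  exact ⟨K.map φ, IsHomLift.map q (K.map φ)⟩

end Transports

namespace IsDiscreteOpfibration

variable {p : P ⥤ Y} (hp : IsDiscreteOpfibration p)

include hp

theorem exists_transports {a : P} {y y' : Y} (g : y ⟶ y') (ha : p.obj a = y) :
    ∃ b, Transports p g a b := by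
  subst ha
  obtain ⟨⟨b, φ⟩, hφ, -⟩ := hp a g
  exact ⟨b, φ, hφ⟩

theorem sigma_eq {a b b' : P} {y y' : Y} (g : y ⟶ y') (φ : a ⟶ b) (φ' : a ⟶ b')
    (hφ : p.IsHomLift g φ) (hφ' : p.IsHomLift g φ') :
    (⟨b, φ⟩ : Σ b : P, a ⟶ b) = ⟨b', φ'⟩ := by
  obtain rfl := IsHomLift.domain_eq p g φ
  exact (hp a g).unique hφ hφ'

theorem eq_of_transports {a b b' : P} {y y' : Y} {g : y ⟶ y'} (h : Transports p g a b)
    (h' : Transports p g a b') : b = b' := by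
  obtain ⟨φ, hφ⟩ := h
  obtain ⟨φ', hφ'⟩ := h'
  exact congrArg Sigma.fst (hp.sigma_eq g φ φ' hφ hφ')

theorem hom_eq {a b : P} {y y' : Y} (g : y ⟶ y') (φ φ' : a ⟶ b)
    (hφ : p.IsHomLift g φ) (hφ' : p.IsHomLift g φ') : φ = φ' :=
  eq_of_heq (Sigma.mk.inj (hp.sigma_eq g φ φ' hφ hφ')).2

/-- Two functors into a discrete opfibration agree as soon as they agree on objects and over the
base. -/
theorem functor_ext {A : Type u₃} [Category.{v₃} A] {K K' : A ⥤ P} (h : K ⋙ p = K' ⋙ p)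
    (hobj : ∀ a, K.obj a = K'.obj a) : K = K' := by
  refine CategoryTheory.Functor.ext hobj fun a b φ => ?_
  have : p.IsHomLift ((K ⋙ p).map φ) (K'.map φ) := by
    rw [h]
    exact IsHomLift.map p (K'.map φ)
  exact hp.hom_eq ((K ⋙ p).map φ) _ _ (IsHomLift.map p (K.map φ)) inferInstance

/-- A functor over `Y` into a discrete opfibration amounts to a map on objects which is compatible
with transport along the images of arrows. -/
theorem exists_functor {A : Type u₃} [Category.{v₃} A] (r : A ⥤ Y) (K : A → P)
    (hK : ∀ ⦃a b : A⦄ (φ : a ⟶ b), Transports p (r.map φ) (K a) (K b)) :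
    ∃ F : A ⥤ P, F ⋙ p = r ∧ ∀ a, F.obj a = K a := by
  choose φ hφ using hK
  let F : A ⥤ P :=
    { obj := K
      map := fun ψ => φ ψ
      map_id := fun a => by
        refine hp.hom_eq (r.map (𝟙 a)) _ _ (hφ _) ?_
        rw [r.map_id]
        exact IsHomLift.id (IsHomLift.domain_eq p (r.map (𝟙 a)) (φ (𝟙 a)))
      map_comp := fun ψ χ => by
        refine hp.hom_eq (r.map (ψ ≫ χ)) _ _ (hφ _) ?_
        rw [r.map_comp]
        infer_instance }
  refine ⟨F, CategoryTheory.Functor.ext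
    (fun a => IsHomLift.domain_eq p (r.map (𝟙 a)) (φ (𝟙 a))) fun a b ψ => ?_, fun a => rfl⟩
  exact IsHomLift.fac' p (r.map ψ) (φ ψ)

end IsDiscreteOpfibration

end Transport

/-! ### Unique extension along the pullback of a functor -/

section Extension

variable {X : Type u₁} [Category.{v₁} X] {Y : Type u₂} [Category.{v₂} Y]

/-- Functors over `X` from `f^*p` to `f^*q` come from unique functors over `Y` from `p` to `q`,
where functors over `X` into `f^*q` are identified with functors into the domain of `q` lying
over `f`. -/
def ExtendsUniquely {P Q : Type*} [Category* P] [Category* Q] (f : X ⥤ Y) (p : P ⥤ Y)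
    (q : Q ⥤ Y) : Prop :=
  ∀ k : StrictPullback f p ⥤ Q, k ⋙ q = StrictPullback.fstFunctor f p ⋙ f →
    ∃! K : P ⥤ Q, K ⋙ q = p ∧ StrictPullback.sndFunctor f p ⋙ K = k

variable {P : Type*} [Category* P] {Q : Type*} [Category* Q] {f : X ⥤ Y} {p : P ⥤ Y} {q : Q ⥤ Y}

/-- `IsExtensionValue k α s u` says that `u` is obtained from `s` by transport along the first
factor of some factorisation of `α` through `f`, application of `k`, and transport along the second
factor. An extension `K` of `k` has to send `s` to such a `u` when `α` is an identity. -/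
def IsExtensionValue (q : Q ⥤ Y) (k : StrictPullback f p ⥤ Q) {x y : Y} (α : x ⟶ y) (s : P)
    (u : Q) : Prop :=
  ∃ (t : FactorisationThrough f α) (s' : P) (w : f.obj t.mid = p.obj s'),
    Transports p t.ι s s' ∧ Transports q t.π (k.obj ⟨t.mid, s', w⟩) u

namespace IsExtensionValue

variable {k : StrictPullback f p ⥤ Q} {x y z : Y} {α : x ⟶ y} {s : P} {u : Q}

theorem comp_right (h : IsExtensionValue q k α s u) {g : y ⟶ z} {u' : Q}
    (hu : Transports q g u u') : IsExtensionValue q k (α ≫ g) s u' := by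
  obtain ⟨t, s', w, h₁, h₂⟩ := h
  exact ⟨⟨t.mid, t.ι, t.π ≫ g, by rw [← Category.assoc, t.ι_π]⟩, s', w, h₁, h₂.comp hu⟩

theorem comp_left (h : IsExtensionValue q k α s u) {g : z ⟶ x} {s₀ : P}
    (hs : Transports p g s₀ s) : IsExtensionValue q k (g ≫ α) s₀ u := by
  obtain ⟨t, s', w, h₁, h₂⟩ := h
  exact ⟨⟨t.mid, g ≫ t.ι, t.π, by rw [Category.assoc, t.ι_π]⟩, s', w, hs.comp h₁, h₂⟩

end IsExtensionValue

variable (hp : IsDiscreteOpfibration p) (hq : IsDiscreteOpfibration q)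
  {k : StrictPullback f p ⥤ Q} (hk : k ⋙ q = StrictPullback.fstFunctor f p ⋙ f)

include hp hq hk

/-- Factorisations joined by an arrow have the same extension value. -/
theorem extensionValue_eq_of_hom {x y : Y} {α : x ⟶ y} {t₁ t₂ : FactorisationThrough f α}
    (h : t₁ ⟶ t₂) {s s₁ s₂ : P} {u₁ u₂ : Q} (w₁ : f.obj t₁.mid = p.obj s₁)
    (w₂ : f.obj t₂.mid = p.obj s₂) (hs₁ : Transports p t₁.ι s s₁) (hs₂ : Transports p t₂.ι s s₂)
    (hu₁ : Transports q t₁.π (k.obj ⟨t₁.mid, s₁, w₁⟩) u₁)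
    (hu₂ : Transports q t₂.π (k.obj ⟨t₂.mid, s₂, w₂⟩) u₂) : u₁ = u₂ := by
  obtain ⟨s₃, hs₃⟩ := hp.exists_transports (f.map h.h) hs₁.obj_codomain
  obtain rfl : s₂ = s₃ := by
    have := hs₁.comp hs₃
    rw [h.ι_h] at this
    exact hp.eq_of_transports hs₂ this
  obtain ⟨l, hl⟩ := hs₃
  let m : (⟨t₁.mid, s₁, w₁⟩ : StrictPullback f p) ⟶ ⟨t₂.mid, s₂, w₂⟩ :=
    ⟨h.h, l, by
      rw [IsHomLift.fac' p (f.map h.h) l]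
      simp⟩
  have hm : Transports q (f.map h.h) (k.obj ⟨t₁.mid, s₁, w₁⟩) (k.obj ⟨t₂.mid, s₂, w₂⟩) :=
    (Transports.map (StrictPullback.fstFunctor f p ⋙ f) m).map_functor hk
  have := hm.comp hu₂
  rw [h.h_π] at this
  exact hq.eq_of_transports hu₁ this

theorem existsUnique_extensionValue {x y : Y} (α : x ⟶ y)
    [IsConnected (FactorisationThrough f α)] (s : P) (hs : p.obj s = x) :
    ∃! u, IsExtensionValue q k α s u := by
  have key (t : FactorisationThrough f α) : ∃ (s' : P) (w : f.obj t.mid = p.obj s') (u : Q),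
      Transports p t.ι s s' ∧ Transports q t.π (k.obj ⟨t.mid, s', w⟩) u := by
    obtain ⟨s', hs'⟩ := hp.exists_transports t.ι hs
    obtain ⟨u, hu⟩ := hq.exists_transports (a := k.obj ⟨t.mid, s', hs'.obj_codomain.symm⟩) t.π
      (Functor.congr_obj hk _)
    exact ⟨s', _, u, hs', hu⟩
  choose S w U hS hU using key
  have const (t t' : FactorisationThrough f α) : U t = U t' :=
    constant_of_preserves_morphisms U (fun t₁ t₂ h =>
      extensionValue_eq_of_hom hp hq hk h (w t₁) (w t₂) (hS t₁) (hS t₂) (hU t₁) (hU t₂)) t t'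
  let t₀ : FactorisationThrough f α := Classical.arbitrary _
  refine ⟨U t₀, ⟨t₀, S t₀, w t₀, hS t₀, hU t₀⟩, ?_⟩
  rintro u ⟨t, s', w', hs', hu⟩
  rw [const t₀ t]
  exact extensionValue_eq_of_hom hp hq hk (𝟙 t) w' (w t) hs' (hS t) hu (hU t)

omit hk in
/-- The extension of `k` sends `s` to its extension value along the identity of `p s`. -/
theorem HasConnectedFactorisations.extendsUniquely (hf : HasConnectedFactorisations f) :
    ExtendsUniquely f p q := by
  intro k hk
  have huniq {x y : Y} (α : x ⟶ y) (s : P) (hs : p.obj s = x) :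
      ∃! u, IsExtensionValue q k α s u :=
    have := hf α
    existsUnique_extensionValue hp hq hk α s hs
  choose K hK _ using fun s => huniq (𝟙 (p.obj s)) s rfl
  have hqK (s : P) : q.obj (K s) = p.obj s := by
    obtain ⟨_, _, _, _, h⟩ := hK s
    exact h.obj_codomain
  -- Both `K b` and the transport of `K a` are extension values of `a` along the same arrow.
  have hmap ⦃a b : P⦄ (φ : a ⟶ b) : Transports q (p.map φ) (K a) (K b) := by
    obtain ⟨u, hu⟩ := hq.exists_transports (p.map φ) (hqK a)
    have h₁ := (hK a).comp_right hu
    have h₂ := (hK b).comp_left (Transports.map p φ)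
    rw [Category.id_comp] at h₁
    rw [Category.comp_id] at h₂
    rwa [(huniq (p.map φ) a rfl).unique h₂ h₁]
  obtain ⟨F, hF, hFK⟩ := hq.exists_functor p K hmap
  refine ⟨F, ⟨hF, ?_⟩, ?_⟩
  · refine hq.functor_ext ?_ fun a => ?_
    · rw [Functor.assoc, hF, hk, StrictPullback.condition]
    · refine (hFK a.snd).trans ((huniq (𝟙 (p.obj a.snd)) a.snd rfl).unique (hK _) ?_)
      exact ⟨⟨a.fst, eqToHom a.w.symm, eqToHom a.w, by simp⟩, a.snd, a.w,
        .eqToHom rfl a.w.symm a.w.symm, .eqToHom (p := q) (Functor.congr_obj hk a)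
          ((Functor.congr_obj hk a).trans a.w) a.w⟩
  · rintro F' ⟨hF', hF'k⟩
    refine hq.functor_ext (hF'.trans hF.symm) fun s => ?_
    refine ((huniq (𝟙 (p.obj s)) s rfl).unique ?_ (hK s)).trans (hFK s).symm
    have := hf (𝟙 (p.obj s))
    let t : FactorisationThrough f (𝟙 (p.obj s)) := Classical.arbitrary _
    obtain ⟨s', hs'⟩ := hp.exists_transports t.ι rfl
    have w : f.obj t.mid = p.obj s' := hs'.obj_codomain.symm
    have hks' : k.obj ⟨t.mid, s', w⟩ = F'.obj s' := (Functor.congr_obj hF'k ⟨t.mid, s', w⟩).symm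
    obtain ⟨u, hu⟩ := hq.exists_transports (a := F'.obj s') t.π
      ((Functor.congr_obj hF' s').trans w.symm)
    refine ⟨t, s', w, hs', ?_⟩
    have h₁ := (hs'.map_functor hF').comp hu
    rw [t.ι_π] at h₁
    have h₂ : Transports q (𝟙 (p.obj s)) (F'.obj s) (F'.obj s) :=
      .eqToHom (p := q) (Functor.congr_obj hF' s) (Functor.congr_obj hF' s) rfl
    rw [hks', hq.eq_of_transports h₂ h₁]
    exact hu

end Extension

/-! ### Components of factorisations as a discrete opfibration -/

section Components

variable {X : Type u₁} [Category.{v₁} X] {Y : Type u₂} [Category.{v₂} Y]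

/-- A composable pair of arrows `x ⟶ f z ⟶ y`. -/
structure FactoredArrow (f : X ⥤ Y) (x y : Y) where
  /-- The object of `X` through which the composite factors. -/
  mid : X
  /-- The first factor. -/
  ι : x ⟶ f.obj mid
  /-- The second factor. -/
  π : f.obj mid ⟶ y

namespace FactoredArrow

variable {f : X ⥤ Y} {x y z : Y}

/-- Two factored arrows are related if there is an arrow between the middle objects compatible with
both factors. -/
def Rel (s t : FactoredArrow f x y) : Prop :=
  ∃ h : s.mid ⟶ t.mid, s.ι ≫ f.map h = t.ι ∧ f.map h ≫ t.π = s.π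

theorem Rel.ι_π_eq {s t : FactoredArrow f x y} (h : Rel s t) : s.ι ≫ s.π = t.ι ≫ t.π := by
  obtain ⟨h, h₁, h₂⟩ := h
  rw [← h₁, ← h₂, Category.assoc]

/-- Postcomposition of the second factor. -/
def comp (s : FactoredArrow f x y) (g : y ⟶ z) : FactoredArrow f x z := ⟨s.mid, s.ι, s.π ≫ g⟩

theorem comp_id (s : FactoredArrow f x y) : s.comp (𝟙 y) = s := by
  simp [comp]

theorem comp_comp {w : Y} (s : FactoredArrow f x y) (g : y ⟶ z) (g' : z ⟶ w) :
    s.comp (g ≫ g') = (s.comp g).comp g' := by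
  simp [comp]

theorem Rel.comp {s t : FactoredArrow f x y} (h : Rel s t) (g : y ⟶ z) :
    Rel (s.comp g) (t.comp g) := by
  obtain ⟨h, h₁, h₂⟩ := h
  exact ⟨h, h₁, (Category.assoc _ _ _).symm.trans (congrArg (· ≫ g) h₂)⟩

/-- Factored arrows of the same class have the same composite and lie in the same component of its
category of factorisations. -/
theorem zigzag_of_mk_eq {s : FactoredArrow f x y} {α : x ⟶ y}
    (t₀ : FactorisationThrough f α) (h : Quot.mk Rel ⟨t₀.mid, t₀.ι, t₀.π⟩ = Quot.mk Rel s) :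
    ∃ e : s.ι ≫ s.π = α, Zigzag t₀ ⟨s.mid, s.ι, s.π, e⟩ := by
  -- Membership in the component of `t₀` is invariant under `Rel`, hence a predicate on classes.
  let D : Quot (Rel (f := f) (x := x) (y := y)) → Prop :=
    Quot.lift (fun s => ∃ e : s.ι ≫ s.π = α, Zigzag t₀ ⟨s.mid, s.ι, s.π, e⟩) (by
      rintro s t hst
      have hc := hst.ι_π_eq
      obtain ⟨h, h₁, h₂⟩ := hst
      refine propext ⟨?_, ?_⟩
      · rintro ⟨e, hz⟩
        exact ⟨hc.symm.trans e, hz.trans (Zigzag.of_hom ⟨h, h₁, h₂⟩)⟩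
      · rintro ⟨e, hz⟩
        exact ⟨hc.trans e, hz.trans (Zigzag.of_inv ⟨h, h₁, h₂⟩)⟩)
  have : D (Quot.mk Rel ⟨t₀.mid, t₀.ι, t₀.π⟩) = D (Quot.mk Rel s) := congrArg D h
  exact this.mp ⟨t₀.ι_π, Zigzag.refl _⟩

variable (f x)

/-- The functor sending `y` to the set of components of the category of composable pairs
`x ⟶ f z ⟶ y`: the left Kan extension along `f` of the restriction to `X` of the functor
represented by `x`. -/
def components : Y ⥤ Type (max u₁ v₂) where
  obj y := Quot (Rel (f := f) (x := x) (y := y))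
  map g := ↾(Quot.map (fun s => s.comp g) fun _ _ h => h.comp g)
  map_id y := by
    ext ⟨s⟩
    exact congrArg (Quot.mk Rel) s.comp_id
  map_comp g g' := by
    ext ⟨s⟩
    exact congrArg (Quot.mk Rel) (s.comp_comp g g')

variable {f x} in
/-- The composite of a class of factored arrows. -/
def composite {y : Y} : (components f x).obj y → (x ⟶ y) :=
  Quot.lift (fun s => s.ι ≫ s.π) fun _ _ h => h.ι_π_eq

theorem composite_map {y z : Y} (c : (components f x).obj y) (g : y ⟶ z) :
    composite ((components f x).map g c) = composite c ≫ g := by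
  obtain ⟨s⟩ := c
  exact (Category.assoc _ _ _).symm

/-- Composition of factored arrows, as a functor over `Y` to the coslice under `x`. -/
def componentsToUnder : (components f x).Elements ⥤ Under x where
  obj e := Under.mk (composite e.2)
  map φ := Under.homMk φ.1 ((composite_map f x _ _).symm.trans (congrArg composite φ.2))

variable {f x} in
theorem hom_comp_map_fst {a b : StrictPullback f (Under.forget x)} (φ : a ⟶ b) :
    (a.snd.hom ≫ eqToHom a.w.symm) ≫ f.map φ.fst = b.snd.hom ≫ eqToHom b.w.symm := by
  obtain ⟨z, ⟨_, w, a⟩, h⟩ := a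
  obtain ⟨z', ⟨_, w', b⟩, h'⟩ := b
  obtain rfl : f.obj z = w := h
  obtain rfl : f.obj z' = w' := h'
  obtain ⟨φ, ψ, h⟩ := φ
  have h : f.map φ = ψ.right := (comp_eqToHom_self_iff rfl rfl).1 h
  have hψ : a ≫ ψ.right = b := Under.w ψ
  have H {y y' : Y} {a : x ⟶ y} {b : x ⟶ y'} {m n : y ⟶ y'} (h : m = n) (h' : a ≫ n = b) :
      (a ≫ 𝟙 y) ≫ m = b ≫ 𝟙 y' := by simp [h, h']
  exact H h hψ

/-- The unit of the Kan extension `components f x`, as a functor over `Y` on total categories. -/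
def underToComponents :
    StrictPullback f (Under.forget x) ⥤ (components f x).Elements where
  obj a := ⟨a.snd.right, Quot.mk _ ⟨a.fst, a.snd.hom ≫ eqToHom a.w.symm, eqToHom a.w⟩⟩
  map φ := CategoryOfElements.homMk _ _ φ.snd.right
    (Quot.sound ⟨φ.fst, hom_comp_map_fst φ, φ.w⟩)

end FactoredArrow

theorem isDiscreteOpfibration_elements_π (F : Y ⥤ Type u₃) :
    IsDiscreteOpfibration (CategoryOfElements.π F) := by
  rintro ⟨y, s⟩ y' g
  refine ⟨⟨⟨y', F.map g s⟩, g, rfl⟩, IsHomLift.map (CategoryOfElements.π F)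
    (a := ⟨y, s⟩) (b := ⟨y', F.map g s⟩) ⟨g, rfl⟩, ?_⟩
  rintro ⟨⟨y'', s'⟩, φ⟩ (h : (CategoryOfElements.π F).IsHomLift g φ)
  obtain rfl : y'' = y' :=
    @IsHomLift.codomain_eq _ _ _ _ (CategoryOfElements.π F) _ _ _ _ g φ h
  obtain rfl : g = φ.1 :=
    @IsHomLift.eq_of_isHomLift _ _ _ _ (CategoryOfElements.π F) _ _ g φ h
  suffices H : ∀ (s' : F.obj y'') (h : F.map φ.1 s = s'),
      (⟨⟨y'', s'⟩, ⟨φ.1, h⟩⟩ : Σ b : F.Elements, F.elementsMk y s ⟶ b) =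
        ⟨⟨y'', F.map φ.1 s⟩, ⟨φ.1, rfl⟩⟩ from H s' φ.2
  rintro _ rfl
  rfl

theorem isDiscreteOpfibration_underForget (x : Y) : IsDiscreteOpfibration (Under.forget x) := by
  intro a y g
  refine ⟨⟨Under.mk (a.hom ≫ g), Under.homMk g⟩, IsHomLift.map (Under.forget x) (a := a)
    (b := Under.mk (a.hom ≫ g)) (Under.homMk g), ?_⟩
  rintro ⟨⟨_, z, b⟩, φ⟩ (h : (Under.forget x).IsHomLift g φ)
  obtain rfl : z = y :=
    @IsHomLift.codomain_eq _ _ _ _ (Under.forget x) _ _ _ _ g φ h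
  obtain rfl : g = φ.right :=
    @IsHomLift.eq_of_isHomLift _ _ _ _ (Under.forget x) _ _ g φ h
  suffices H : ∀ (b : x ⟶ z) (h : a.hom ≫ φ.right = b),
      (⟨Under.mk b, Under.homMk φ.right h⟩ : Σ b : Under x, a ⟶ b) =
        ⟨Under.mk (a.hom ≫ φ.right), Under.homMk φ.right⟩ from H b (Under.w φ)
  rintro _ rfl
  rfl

open FactoredArrow in
/-- If functors under `x` extend uniquely, both to the coslice and to the components of
factorisations, then the arrows out of `x` have connected categories of factorisations: the
extension of the unit picks a component of factorisations of every `α : x ⟶ y`, to which every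
factorisation of `α` belongs by functoriality; this component is one of factorisations of `α` by
uniqueness. -/
theorem isConnected_factorisationThrough {f : X ⥤ Y} {x : Y}
    (h₁ : ExtendsUniquely f (Under.forget x) (CategoryOfElements.π (components f x)))
    (h₂ : ExtendsUniquely f (Under.forget x) (Under.forget x)) {y : Y} (α : x ⟶ y) :
    IsConnected (FactorisationThrough f α) := by
  obtain ⟨K, ⟨hK, hKu⟩, -⟩ := h₁ (underToComponents f x)
    (StrictPullback.condition f (Under.forget x)).symm
  -- `K ⋙ componentsToUnder f x` and the identity both extend the second projection.
  have hid : K ⋙ componentsToUnder f x = 𝟭 (Under x) := by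
    refine (h₂ (StrictPullback.sndFunctor f (Under.forget x))
      (StrictPullback.condition f (Under.forget x)).symm).unique ⟨hK, ?_⟩ ⟨rfl, rfl⟩
    rw [← Functor.assoc, hKu]
    refine (isDiscreteOpfibration_underForget x).functor_ext rfl fun a => ?_
    obtain ⟨z, ⟨_, w, a⟩, h⟩ := a
    obtain rfl : f.obj z = w := h
    exact congrArg Under.mk (by simp : (a ≫ 𝟙 (f.obj z)) ≫ 𝟙 (f.obj z) = a)
  -- `K` sends `t.ι` to the class of `⟨t.mid, t.ι, 𝟙 _⟩`; transport this along `t.π`.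
  have hfac (t : FactorisationThrough f α) :
      K.obj (Under.mk α) = ⟨y, Quot.mk _ ⟨t.mid, t.ι, t.π⟩⟩ := by
    have hKt : K.obj (Under.mk t.ι) = ⟨f.obj t.mid, Quot.mk _ ⟨t.mid, t.ι, 𝟙 _⟩⟩ := by
      refine (Functor.congr_obj hKu ⟨t.mid, Under.mk t.ι, rfl⟩).trans ?_
      exact congrArg (fun a => (components f x).elementsMk (f.obj t.mid)
        (Quot.mk _ ⟨t.mid, a, 𝟙 _⟩)) (Category.comp_id t.ι)
    have l₁ : Transports (CategoryOfElements.π (components f x)) t.π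
        (K.obj (Under.mk t.ι)) (K.obj (Under.mk α)) :=
      Transports.map_functor hK
        (Transports.map (Under.forget x)
          (Under.homMk (U := Under.mk t.ι) (V := Under.mk α) t.π t.ι_π))
    rw [hKt] at l₁
    have l₂ := Transports.map (CategoryOfElements.π (components f x))
      (CategoryOfElements.homMk
        ((components f x).elementsMk (f.obj t.mid) (Quot.mk _ ⟨t.mid, t.ι, 𝟙 _⟩))
        ((components f x).elementsMk y (Quot.mk _ ⟨t.mid, t.ι, t.π⟩)) t.π
        (congrArg (fun b => Quot.mk Rel ⟨t.mid, t.ι, b⟩) (Category.id_comp t.π)))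
    exact (isDiscreteOpfibration_elements_π _).eq_of_transports l₁ l₂
  have : Nonempty (FactorisationThrough f α) := by
    have h := Functor.congr_obj hid (Under.mk α)
    rw [Functor.comp_obj] at h
    generalize K.obj (Under.mk α) = e at h
    obtain ⟨y', ⟨s⟩⟩ := e
    obtain rfl : y' = y := congrArg Comma.right h
    have : s.ι ≫ s.π = α := by injection h
    exact ⟨⟨s.mid, s.ι, s.π, this⟩⟩
  refine zigzag_isConnected fun t t' => ?_
  have h := (hfac t).symm.trans (hfac t')
  exact (zigzag_of_mk_eq t (eq_of_heq (Sigma.mk.inj h).2)).2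

end Components

/-! ### Full faithfulness of pullback as unique extension -/

section FullyFaithful

theorem StrictPullback.functor_ext {A : Type u₁} [Category.{v₁} A] {B : Type u₂} [Category.{v₂} B]
    {C : Type u₃} [Category.{v₃} C] {F : A ⥤ C} {G : B ⥤ C} {D : Type*} [Category* D]
    {S T : D ⥤ StrictPullback F G}
    (h₁ : S ⋙ StrictPullback.fstFunctor F G = T ⋙ StrictPullback.fstFunctor F G)
    (h₂ : S ⋙ StrictPullback.sndFunctor F G = T ⋙ StrictPullback.sndFunctor F G) : S = T := by
  have key {S₁ T₁ : D ⥤ A} {S₂ T₂ : D ⥤ B} (hS : S₁ ⋙ F = S₂ ⋙ G) (hT : T₁ ⋙ F = T₂ ⋙ G)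
      (h₁ : S₁ = T₁) (h₂ : S₂ = T₂) :
      StrictPullback.lift S₁ S₂ hS = StrictPullback.lift T₁ T₂ hT := by
    subst h₁ h₂
    rfl
  exact key (congrArg (S ⋙ ·) (StrictPullback.condition F G))
    (congrArg (T ⋙ ·) (StrictPullback.condition F G)) h₁ h₂

variable {X Y : Cat.{v, u}} (f : X ⟶ Y)

theorem bijective_catPullback_map_iff (p q : Over Y) :
    Function.Bijective ((catPullback f).map : (p ⟶ q) → _) ↔
      ExtendsUniquely f.toFunctor p.hom.toFunctor q.hom.toFunctor := by
  have hw (K : p ⟶ q) : K.left.toFunctor ⋙ q.hom.toFunctor = p.hom.toFunctor :=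
    congrArg Cat.Hom.toFunctor (Over.w K)
  -- An arrow into the pullback of `q` is determined by its second component.
  have hmap (K : p ⟶ q) (m : (catPullback f).obj p ⟶ (catPullback f).obj q)
      (h : StrictPullback.sndFunctor f.toFunctor p.hom.toFunctor ⋙ K.left.toFunctor =
        m.left.toFunctor ⋙ StrictPullback.sndFunctor f.toFunctor q.hom.toFunctor) :
      (catPullback f).map K = m := by
    refine Over.OverMorphism.ext (Cat.Hom.ext (StrictPullback.functor_ext ?_ h))
    exact (congrArg Cat.Hom.toFunctor (Over.w m)).symm
  refine ⟨fun ⟨hinj, hsurj⟩ k hk => ?_, fun h => ⟨fun K K' hKK' => ?_, fun m => ?_⟩⟩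
  · let m : (catPullback f).obj p ⟶ (catPullback f).obj q :=
      Over.homMk (Cat.Hom.ofFunctor (StrictPullback.lift
        (StrictPullback.fstFunctor f.toFunctor p.hom.toFunctor) k hk.symm)) rfl
    obtain ⟨K, hK⟩ := hsurj m
    have hKk : StrictPullback.sndFunctor f.toFunctor p.hom.toFunctor ⋙ K.left.toFunctor = k :=
      congrArg (fun l : (catPullback f).obj p ⟶ (catPullback f).obj q =>
        l.left.toFunctor ⋙ StrictPullback.sndFunctor f.toFunctor q.hom.toFunctor) hK
    refine ⟨K.left.toFunctor, ⟨hw K, hKk⟩, ?_⟩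
    rintro K' ⟨h₁, h₂⟩
    have h₃ : (Over.homMk (Cat.Hom.ofFunctor K') (Cat.Hom.ext h₁) : p ⟶ q) = K :=
      hinj ((hmap _ m h₂).trans hK.symm)
    exact congrArg (fun l : p ⟶ q => l.left.toFunctor) h₃
  · have h₁ : StrictPullback.sndFunctor f.toFunctor p.hom.toFunctor ⋙ K.left.toFunctor =
        StrictPullback.sndFunctor f.toFunctor p.hom.toFunctor ⋙ K'.left.toFunctor :=
      congrArg (fun l : (catPullback f).obj p ⟶ (catPullback f).obj q =>
        l.left.toFunctor ⋙ StrictPullback.sndFunctor f.toFunctor q.hom.toFunctor) hKK'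
    refine Over.OverMorphism.ext (Cat.Hom.ext ((h _ ?_).unique ⟨hw K, h₁⟩ ⟨hw K', rfl⟩))
    rw [Functor.assoc, hw, StrictPullback.condition]
  · obtain ⟨K, ⟨h₁, h₂⟩, -⟩ := h
      (m.left.toFunctor ⋙ StrictPullback.sndFunctor f.toFunctor q.hom.toFunctor)
      ((congrArg (m.left.toFunctor ⋙ ·)
        (StrictPullback.condition f.toFunctor q.hom.toFunctor)).symm.trans
        (congrArg (fun l : ((catPullback f).obj p).left ⟶ X => l.toFunctor ⋙ f.toFunctor)
          (Over.w m)))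
    exact ⟨Over.homMk (Cat.Hom.ofFunctor K) (Cat.Hom.ext h₁), hmap _ m h₂⟩

theorem full_and_faithful_lift_catPullback_iff (P : ObjectProperty (Over Y))
    (P' : ObjectProperty (Over X))
    (h : ∀ p : P.FullSubcategory, P' ((P.ι ⋙ catPullback f).obj p)) :
    ((P'.lift (P.ι ⋙ catPullback f) h).Full ∧ (P'.lift (P.ι ⋙ catPullback f) h).Faithful) ↔
      ∀ p q : Over Y, P p → P q →
        ExtendsUniquely f.toFunctor p.hom.toFunctor q.hom.toFunctor := by
  simp only [← bijective_catPullback_map_iff]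
  constructor
  · rintro ⟨_, _⟩ p q hp hq
    let p' : P.FullSubcategory := ⟨p, hp⟩
    let q' : P.FullSubcategory := ⟨q, hq⟩
    refine ⟨fun K K' hK => ?_, fun m => ?_⟩
    · have : (ObjectProperty.homMk K : p' ⟶ q') = ObjectProperty.homMk K' :=
        (P'.lift (P.ι ⋙ catPullback f) h).map_injective (ObjectProperty.hom_ext _ hK)
      exact congrArg InducedCategory.Hom.hom this
    · obtain ⟨K, hK⟩ := (P'.lift (P.ι ⋙ catPullback f) h).map_surjective
        (X := p') (Y := q') (ObjectProperty.homMk m)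
      exact ⟨K.hom, congrArg (fun l : (P'.lift (P.ι ⋙ catPullback f) h).obj p' ⟶
        (P'.lift (P.ι ⋙ catPullback f) h).obj q' => l.hom) hK⟩
  · intro H
    refine ⟨⟨fun {p q} m => ?_⟩, ⟨fun {p q} K K' hK => ?_⟩⟩
    · obtain ⟨K, hK⟩ := (H p.obj q.obj p.property q.property).2 m.hom
      exact ⟨ObjectProperty.homMk K, ObjectProperty.hom_ext _ hK⟩
    · exact ObjectProperty.hom_ext _ ((H p.obj q.obj p.property q.property).1
        (congrArg (fun l : (P'.lift (P.ι ⋙ catPullback f) h).obj p ⟶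
          (P'.lift (P.ι ⋙ catPullback f) h).obj q => l.hom) hK))

end FullyFaithful

/-! ### Duality -/

section Duality

variable {X : Type u₁} [Category.{v₁} X] {Y : Type u₂} [Category.{v₂} Y]

theorem op_comp_eqToHom {a b c d : Y} {g : a ⟶ b} {g' : c ⟶ d} {h : b = d} {h' : a = c}
    (w : g ≫ eqToHom h = eqToHom h' ≫ g') (k : Opposite.op a = .op c) (k' : Opposite.op b = .op d) :
    g.op ≫ eqToHom k = eqToHom k' ≫ g'.op := by
  subst h h'
  have w : g = g' := by simpa using w
  simp [w]

theorem unop_comp_eqToHom {a b c d : Yᵒᵖ} {g : a ⟶ b} {g' : c ⟶ d} {h : b = d} {h' : a = c}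
    (w : g ≫ eqToHom h = eqToHom h' ≫ g') (k : a.unop = c.unop) (k' : b.unop = d.unop) :
    g.unop ≫ eqToHom k = eqToHom k' ≫ g'.unop := by
  subst h h'
  have w : g = g' := by simpa using w
  simp [w]

namespace StrictPullback

variable {P : Type u₃} [Category.{v₃} P]

/-- The strict pullback of opposite functors, compared with the opposite of the strict pullback. -/
def opToOp (f : X ⥤ Y) (p : P ⥤ Y) : StrictPullback f.op p.op ⥤ (StrictPullback f p)ᵒᵖ where
  obj a := .op ⟨a.fst.unop, a.snd.unop, congrArg Opposite.unop a.w⟩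
  map φ := .op ⟨φ.fst.unop, φ.snd.unop, unop_comp_eqToHom φ.w _ _⟩

/-- The inverse of `opToOp`, as a functor between the opposite categories. -/
def toOpOp (f : X ⥤ Y) (p : P ⥤ Y) : StrictPullback f p ⥤ (StrictPullback f.op p.op)ᵒᵖ where
  obj a := .op ⟨.op a.fst, .op a.snd, congrArg Opposite.op a.w⟩
  map φ := .op ⟨φ.fst.op, φ.snd.op, op_comp_eqToHom φ.w _ _⟩

/-- The variant of `toOpOp` for a functor with values in an opposite category. -/
def leftOpToOp (f : X ⥤ Y) (p : P ⥤ Yᵒᵖ) :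
    StrictPullback f p.leftOp ⥤ (StrictPullback f.op p)ᵒᵖ where
  obj a := .op ⟨.op a.fst, a.snd.unop, congrArg Opposite.op a.w⟩
  map φ := .op ⟨φ.fst.op, φ.snd.unop, op_comp_eqToHom φ.w _ _⟩

/-- The inverse of `leftOpToOp`, as a functor between the opposite categories. -/
def toOpLeftOp (f : X ⥤ Y) (p : P ⥤ Yᵒᵖ) :
    StrictPullback f.op p ⥤ (StrictPullback f p.leftOp)ᵒᵖ where
  obj a := .op ⟨a.fst.unop, .op a.snd, congrArg Opposite.unop a.w⟩
  map φ := .op ⟨φ.fst.unop, φ.snd.op, unop_comp_eqToHom φ.w _ _⟩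

end StrictPullback

variable {P : Type*} [Category* P] {Q : Type*} [Category* Q]

theorem ExtendsUniquely.of_op {f : X ⥤ Y} {p : P ⥤ Y} {q : Q ⥤ Y}
    (h : ExtendsUniquely f.op p.op q.op) : ExtendsUniquely f p q := by
  intro k hk
  obtain ⟨K, ⟨h₁, h₂⟩, huniq⟩ := h (StrictPullback.opToOp f p ⋙ k.op)
    (congrArg (fun l : StrictPullback f p ⥤ Y => StrictPullback.opToOp f p ⋙ l.op) hk)
  refine ⟨K.unop, ⟨congrArg Functor.unop h₁, congrArg
    (fun l : StrictPullback f.op p.op ⥤ Qᵒᵖ => StrictPullback.toOpOp f p ⋙ l.leftOp) h₂⟩, ?_⟩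
  rintro K' ⟨h₁', h₂'⟩
  exact congrArg Functor.unop (huniq K'.op ⟨congrArg Functor.op h₁',
    congrArg (fun l : StrictPullback f p ⥤ Q => StrictPullback.opToOp f p ⋙ l.op) h₂'⟩)

/-- The converse direction of duality, stated for functors to `Yᵒᵖ` so that no double opposite
occurs. -/
theorem ExtendsUniquely.of_leftOp {f : X ⥤ Y} {p : P ⥤ Yᵒᵖ} {q : Q ⥤ Yᵒᵖ}
    (h : ExtendsUniquely f p.leftOp q.leftOp) : ExtendsUniquely f.op p q := by
  intro k hk
  obtain ⟨K, ⟨h₁, h₂⟩, huniq⟩ := h (StrictPullback.leftOpToOp f p ⋙ k.op) (congrArg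
    (fun l : StrictPullback f.op p ⥤ Yᵒᵖ => StrictPullback.leftOpToOp f p ⋙ l.leftOp) hk)
  refine ⟨K.unop, ⟨congrArg Functor.rightOp h₁, congrArg
    (fun l : StrictPullback f p.leftOp ⥤ Qᵒᵖ => StrictPullback.toOpLeftOp f p ⋙ l.leftOp) h₂⟩, ?_⟩
  rintro K' ⟨h₁', h₂'⟩
  exact congrArg Functor.unop (huniq K'.op ⟨congrArg Functor.leftOp h₁',
    congrArg (fun l : StrictPullback f.op p ⥤ Q => StrictPullback.leftOpToOp f p ⋙ l.op) h₂'⟩)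

theorem IsDiscreteFibration.op {p : P ⥤ Y} (hp : IsDiscreteFibration p) :
    IsDiscreteOpfibration p.op := by
  have lift_op {a b : P} {c c' : Y} {g : c ⟶ c'} {φ : a ⟶ b} (h : p.IsHomLift g φ) :
      p.op.IsHomLift g.op φ.op := by
    obtain ⟨⟩ := h
    exact IsHomLift.map p.op φ.op
  have lift_unop {a b : Pᵒᵖ} {c c' : Yᵒᵖ} {g : c ⟶ c'} {φ : a ⟶ b} (h : p.op.IsHomLift g φ) :
      p.IsHomLift g.unop φ.unop := by
    obtain ⟨⟩ := h
    exact IsHomLift.map p φ.unop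
  intro a c g
  obtain ⟨⟨b, φ⟩, h, huniq⟩ := hp a.unop g.unop
  refine ⟨⟨.op b, φ.op⟩, lift_op h, ?_⟩
  rintro ⟨b', φ'⟩ h'
  exact congrArg (fun s : Σ b : P, b ⟶ a.unop => (⟨.op s.1, s.2.op⟩ : Σ b : Pᵒᵖ, a ⟶ b))
    (huniq ⟨b'.unop, φ'.unop⟩ (lift_unop h'))

theorem IsDiscreteOpfibration.leftOp {p : P ⥤ Yᵒᵖ} (hp : IsDiscreteOpfibration p) :
    IsDiscreteFibration p.leftOp := by
  have lift_op {a b : P} {c c' : Yᵒᵖ} {g : c ⟶ c'} {φ : a ⟶ b} (h : p.IsHomLift g φ) :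
      p.leftOp.IsHomLift g.unop φ.op := by
    obtain ⟨⟩ := h
    exact IsHomLift.map p.leftOp φ.op
  have lift_unop {a b : Pᵒᵖ} {c c' : Y} {g : c ⟶ c'} {φ : a ⟶ b} (h : p.leftOp.IsHomLift g φ) :
      p.IsHomLift g.op φ.unop := by
    obtain ⟨⟩ := h
    exact IsHomLift.map p φ.unop
  intro a c g
  obtain ⟨⟨b, φ⟩, h, huniq⟩ := hp a.unop g.op
  refine ⟨⟨.op b, φ.op⟩, lift_op h, ?_⟩
  rintro ⟨b', φ'⟩ h'
  exact congrArg (fun s : Σ b : P, a.unop ⟶ b => (⟨.op s.1, s.2.op⟩ : Σ b : Pᵒᵖ, b ⟶ a))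
    (huniq ⟨b'.unop, φ'.unop⟩ (lift_unop h'))

end Duality

/-! ### The equivalences -/

theorem discreteOpfibrationPullback_full_and_faithful_iff {X Y : Cat.{v, max u v}} (f : X ⟶ Y) :
    (discreteOpfibrationPullback f).Full ∧ (discreteOpfibrationPullback f).Faithful ↔
      HasConnectedFactorisations f.toFunctor := by
  refine (full_and_faithful_lift_catPullback_iff f _ _ _).trans
    ⟨fun h x y α => isConnected_factorisationThrough ?_ ?_ α,
      fun h p q hp hq => h.extendsUniquely hp hq⟩
  · exact h (Over.mk (Y := Cat.of (Under x)) (Cat.Hom.ofFunctor (Under.forget x)))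
      (Over.mk (Y := Cat.of (FactoredArrow.components f.toFunctor x).Elements)
        (Cat.Hom.ofFunctor (CategoryOfElements.π _)))
      (isDiscreteOpfibration_underForget x) (isDiscreteOpfibration_elements_π _)
  · exact h (Over.mk (Y := Cat.of (Under x)) (Cat.Hom.ofFunctor (Under.forget x)))
      (Over.mk (Y := Cat.of (Under x)) (Cat.Hom.ofFunctor (Under.forget x)))
      (isDiscreteOpfibration_underForget x) (isDiscreteOpfibration_underForget x)

theorem discreteFibrationPullback_full_and_faithful_iff {X Y : Cat.{v, max u v}} (f : X ⟶ Y) :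
    (discreteFibrationPullback f).Full ∧ (discreteFibrationPullback f).Faithful ↔
      HasConnectedFactorisations f.toFunctor := by
  refine (full_and_faithful_lift_catPullback_iff f _ _ _).trans ⟨fun h => ?_, fun h p q hp hq =>
    .of_op (((hasConnectedFactorisations_op_iff _).2 h).extendsUniquely
      (IsDiscreteFibration.op hp) (IsDiscreteFibration.op hq))⟩
  rw [← hasConnectedFactorisations_op_iff]
  intro x y α
  let c : Yᵒᵖ ⥤ Type (max u v) := FactoredArrow.components f.toFunctor.op x
  refine isConnected_factorisationThrough (.of_leftOp ?_) (.of_leftOp ?_) α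
  · exact h (Over.mk (Y := Cat.of (Under x)ᵒᵖ) (Cat.Hom.ofFunctor (Under.forget x).leftOp))
      (Over.mk (Y := Cat.of c.Elementsᵒᵖ) (Cat.Hom.ofFunctor (CategoryOfElements.π c).leftOp))
      (isDiscreteOpfibration_underForget x).leftOp (isDiscreteOpfibration_elements_π _).leftOp
  · exact h (Over.mk (Y := Cat.of (Under x)ᵒᵖ) (Cat.Hom.ofFunctor (Under.forget x).leftOp))
      (Over.mk (Y := Cat.of (Under x)ᵒᵖ) (Cat.Hom.ofFunctor (Under.forget x).leftOp))
      (isDiscreteOpfibration_underForget x).leftOp (isDiscreteOpfibration_underForget x).leftOp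

theorem mainTheorem9 {X Y : Cat.{v, max u v}} (f : X ⟶ Y) :
    List.TFAE
      [∀ {x y : Y} (α : x ⟶ y),
          IsConnected (StrictPullback f.toFunctor (Factorisation.forget (f := α))),
        IsLocallyFinal f.toFunctor,
        IsLocallyInitial f.toFunctor,
        (discreteFibrationPullback f).Full ∧ (discreteFibrationPullback f).Faithful,
        (discreteOpfibrationPullback f).Full ∧ (discreteOpfibrationPullback f).Faithful] := by
  rw [isConnected_strictPullback_factorisation_iff, isLocallyFinal_iff, isLocallyInitial_iff,
    discreteFibrationPullback_full_and_faithful_iff,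
    discreteOpfibrationPullback_full_and_faithful_iff]
  tfae_finish
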